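/- Let $\beta>1$ be a real number and let $T_\beta(x)=\beta x-\lfloor\beta x\rfloor$. For $x\in[0,1)$ and $n\ge 1$ let $\varepsilon_n(x)=\lfloor\beta\,T_\beta^{n-1}x\rfloor$ be the $n$-th digit of the $\beta$-expansion $x=\sum_{n\ge1}\varepsilon_n(x)\beta^{-n}$ of $x$, and let $$\ell_n(x)=\sup\{k\ge 0:\ \varepsilon_{n+1}(x)=\cdots=\varepsilon_{n+k}(x)=0\}\in\{0,1,2,\dots\}\cup\{\infty\}$$ be the length of the longest string of zeros just after the $n$-th digit. Let $\phi:\{1,2,3,\dots\}\to(0,\infty)$ be nondecreasing with $\phi(n)\to\infty$ as $n\to\infty$, and put $$F_\phi=\Big\{x\in[0,1):\ \limsup_{n\to\infty}\frac{\ell_n(x)}{\phi(n)}=1\Big\},$$ where the limsup is taken in $[0,\infty]$. Then $$\dim_{\mathrm H}F_\phi=\frac{1}{1+\liminf_{n\to\infty}\phi(n)/n},$$ where $\dim_{\mathrm H}$ is the Hausdorff dimension and $1/\infty:=0$. -/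

import Mathlib

open Filter
open scoped ENNReal

namespace BetaExpansion

/-- The `β`-transformation `x ↦ β x - ⌊β x⌋`. -/
noncomputable def T (β : ℝ) (x : ℝ) : ℝ :=
  β * x - (⌊β * x⌋ : ℝ)

/-- The `n`-th digit (for `n ≥ 1`) of the `β`-expansion of `x`, namely `⌊β * T^(n-1) x⌋`. -/
noncomputable def digit (β : ℝ) (n : ℕ) (x : ℝ) : ℤ :=
  ⌊β * (T β)^[n - 1] x⌋

/-- The length of the longest string of zeros just after the `n`-th digit in the `β`-expansion
of `x`. It is `⊤` when all digits after the `n`-th one vanish. -/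
noncomputable def zeroRun (β : ℝ) (n : ℕ) (x : ℝ) : ℕ∞ :=
  sSup {K : ℕ∞ | ∃ k : ℕ, K = k ∧ ∀ i : ℕ, 1 ≤ i → i ≤ k → digit β (n + i) x = 0}

/-- The set of `x ∈ [0,1)` with `limsup ℓ_n(x) / φ(n) = 1`, where `ℓ_n(x)` is `zeroRun β n x`
and the limsup is taken in `[0,∞]`. -/
noncomputable def limsupSet (β : ℝ) (φ : ℕ → ℝ) : Set ℝ :=
  {x : ℝ | 0 ≤ x ∧ x < 1 ∧
    limsup (fun n : ℕ => ((zeroRun β n x : ℕ∞) : ℝ≥0∞) / ENNReal.ofReal (φ n)) atTop = 1}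

end BetaExpansion

namespace BetaExpansion

open MeasureTheory Set Topology
open scoped NNReal

/-! The condition `ℓ_n(x) ≥ k` says `T^n x < β^{-k}`. Not every cylinder of order `n` is full, but
each is a full one followed by a rightmost one (`exists_decomposition`). Hence at most `(n+1)β^n`
intervals are needed at order `n`, and there are at least `β^n/(n+1)` full cylinders
(`le_ncard_fullSet`).

Upper bound: for `γ < liminf φ(n)/n`, every point of the set satisfies `T^n x < β^{-⌊γn⌋}`
infinitely often, so it lies in infinitely many of the `(n+1)β^n` intervals of length
`β^{-(n+⌊γn⌋)}`. The `s`-sums converge once `(1+γ)s > 1`.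

Lower bound: full words concatenate freely. For `A > 1 + liminf φ(n)/n`, a Cantor subset is built
from blocks `v 1 0^q`, with `v` an arbitrary full word of order `m`. Infinitely many blocks are
prolonged by `0^d 1 0^{s+q}`, where the added `1` is digit `p` and `s = ⌈φ(p)⌉`. They are inserted
so sparsely that block `i` starts no later than `A(m+q+1)i` (`exists_blocks`). The other zero runs
are bounded, up to the remainder of a long one; since `φ` is nondecreasing and unbounded, the limsup
is exactly 1. The inverse of the coding is Hölder onto `[0,1]` (`le_dimH_range_of_separated`), and
`m → ∞` gives dimension at least `1/A`. -/

/-- `v` is the left endpoint of a full cylinder of order `n`: the `n`-th iterate of `T β` maps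
`[v, v + β⁻ⁿ)` affinely onto `[0, 1)`. -/
structure IsFull (β : ℝ) (n : ℕ) (v : ℝ) : Prop where
  nonneg : 0 ≤ v
  add_le_one : v + β⁻¹ ^ n ≤ 1
  iterate : ∀ z, 0 ≤ z → z < 1 → (T β)^[n] (v + β⁻¹ ^ n * z) = z

variable {β : ℝ}

/-! ### Full cylinders and their concatenation. -/

lemma T_eq_fract (x : ℝ) : T β x = Int.fract (β * x) := rfl

lemma iterate_T_nonneg {x : ℝ} (hx : 0 ≤ x) (n : ℕ) : 0 ≤ (T β)^[n] x := by
  cases n with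
  | zero => exact hx
  | succ n => rw [Function.iterate_succ_apply', T_eq_fract]; exact Int.fract_nonneg _

lemma iterate_T_lt_one {x : ℝ} (hx : x < 1) (n : ℕ) : (T β)^[n] x < 1 := by
  cases n with
  | zero => exact hx
  | succ n => rw [Function.iterate_succ_apply', T_eq_fract]; exact Int.fract_lt_one _

lemma T_eq_of_mem {x : ℝ} (k : ℤ) (h0 : (k : ℝ) ≤ β * x) (h1 : β * x < k + 1) :
    T β x = β * x - k := by
  rw [T, Int.floor_eq_iff.2 ⟨h0, h1⟩]

lemma inv_pow_le_one (hβ : 1 < β) (n : ℕ) : β⁻¹ ^ n ≤ 1 :=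
  pow_le_one₀ (by positivity) (inv_lt_one_of_one_lt₀ hβ).le

lemma inv_pow_pos (hβ : 1 < β) (n : ℕ) : 0 < β⁻¹ ^ n := by positivity

namespace IsFull

lemma append (hβ : 1 < β) {n m : ℕ} {v w : ℝ} (hv : IsFull β n v) (hw : IsFull β m w) :
    IsFull β (n + m) (v + β⁻¹ ^ n * w) := by
  have hp := inv_pow_pos hβ n
  have hq := inv_pow_pos hβ m
  refine ⟨add_nonneg hv.nonneg (mul_nonneg hp.le hw.nonneg), ?_, fun z h0 h1 => ?_⟩
  · have := mul_le_mul_of_nonneg_left hw.add_le_one hp.le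
    have := hv.add_le_one
    rw [pow_add]
    linarith
  · have h2 : w + β⁻¹ ^ m * z < 1 := by nlinarith [hw.add_le_one]
    have h3 : 0 ≤ w + β⁻¹ ^ m * z := add_nonneg hw.nonneg (mul_nonneg hq.le h0)
    have e : v + β⁻¹ ^ n * w + β⁻¹ ^ (n + m) * z = v + β⁻¹ ^ n * (w + β⁻¹ ^ m * z) := by ring
    rw [e, add_comm n m, Function.iterate_add_apply, hv.iterate _ h3 h2, hw.iterate _ h0 h1]

lemma zero (hβ : 1 < β) (n : ℕ) : IsFull β n 0 := by
  have h1 : IsFull β 1 0 := by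
    have hb : 0 < β := by linarith
    refine ⟨le_rfl, by simpa using inv_pow_le_one hβ 1, fun z h0 h1 => ?_⟩
    have e : β * (0 + β⁻¹ ^ 1 * z) = z := by field_simp; ring
    rw [Function.iterate_one, T_eq_of_mem 0 (by rw [e]; simpa) (by rw [e]; simpa), e]
    simp
  induction n with
  | zero => exact ⟨le_rfl, by simp, fun z _ _ => by simp⟩
  | succ n ih => simpa using ih.append hβ h1

lemma mono (hβ : 1 < β) {n m : ℕ} (h : n ≤ m) {v : ℝ} (hv : IsFull β n v) : IsFull β m v := by
  obtain ⟨k, rfl⟩ := Nat.exists_eq_add_of_le h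
  simpa using hv.append hβ (zero hβ k)

/-- This is the word `1 0^n`. The hypothesis only asks that its interval fit inside `[0, 1]`, which
holds once `n` is large. -/
lemma inv (hβ : 1 < β) {n : ℕ} (h : β⁻¹ + β⁻¹ ^ (n + 1) ≤ 1) : IsFull β (n + 1) β⁻¹ := by
  have hb : 0 < β := by linarith
  refine ⟨by positivity, h, fun z h0 h1 => ?_⟩
  have hn := inv_pow_le_one hβ n
  have hp := inv_pow_pos hβ n
  have e : β * (β⁻¹ + β⁻¹ ^ (n + 1) * z) = 1 + β⁻¹ ^ n * z := by
    rw [pow_succ]; field_simp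
  have h2 : β⁻¹ ^ n * z < 1 := by nlinarith
  have h3 : 0 ≤ β⁻¹ ^ n * z := by positivity
  rw [Function.iterate_succ_apply, T_eq_of_mem 1 (by rw [e]; push_cast; linarith)
    (by rw [e]; push_cast; linarith), e]
  simpa using (zero hβ n).iterate z h0 h1

/-- If `w` lay inside the cylinder of `v`, its `n`-th iterate would be positive, whereas fullness at
`w` makes it 0. -/
lemma add_le_of_lt (hβ : 1 < β) {n : ℕ} {v w : ℝ} (hv : IsFull β n v) (hw : IsFull β n w)
    (h : v < w) : v + β⁻¹ ^ n ≤ w := by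
  by_contra! hlt
  have hp := inv_pow_pos hβ n
  have hz : 0 < (w - v) / β⁻¹ ^ n := div_pos (sub_pos.2 h) hp
  have hz1 : (w - v) / β⁻¹ ^ n < 1 := by rw [div_lt_one hp]; linarith
  have h1 := hv.iterate _ hz.le hz1
  rw [mul_div_cancel₀ _ hp.ne', add_sub_cancel] at h1
  have h2 := hw.iterate 0 le_rfl one_pos
  rw [mul_zero, add_zero] at h2
  linarith

end IsFull

/-! ### Zero runs as smallness of iterates. -/

lemma iterate_T_of_lt (hβ : 1 < β) {n : ℕ} {x : ℝ} (h0 : 0 ≤ x) (h1 : x < β⁻¹ ^ n) :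
    (T β)^[n] x = β ^ n * x := by
  have hb : 0 < β := by linarith
  have hp := inv_pow_pos hβ n
  have e : β ^ n * β⁻¹ ^ n = 1 := by rw [← mul_pow, mul_inv_cancel₀ hb.ne', one_pow]
  have := (IsFull.zero hβ n).iterate (β ^ n * x) (by positivity)
    (by rw [← e]; exact mul_lt_mul_of_pos_left h1 (by positivity))
  rwa [zero_add, ← mul_assoc, mul_comm (β⁻¹ ^ n), e, one_mul] at this

/-- If a later iterate is not small, then an earlier one is not small either. -/
lemma inv_pow_le_iterate_T (hβ : 1 < β) {x : ℝ} (hx : 0 ≤ x) {n N j : ℕ} (hn : n ≤ N)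
    (h : β⁻¹ ^ j ≤ (T β)^[N] x) : β⁻¹ ^ (N - n + j) ≤ (T β)^[n] x := by
  by_contra! hlt
  have hb : 0 < β := by linarith
  have hb1 := inv_lt_one_of_one_lt₀ hβ
  have h0 := iterate_T_nonneg (β := β) hx n
  have h1 : (T β)^[n] x < β⁻¹ ^ (N - n) :=
    hlt.trans_le (pow_le_pow_of_le_one (by positivity) hb1.le (by lia))
  have h2 := iterate_T_of_lt hβ h0 h1
  rw [← Function.iterate_add_apply, Nat.sub_add_cancel hn] at h2
  rw [h2] at h
  have h3 := mul_lt_mul_of_pos_left hlt (pow_pos hb (N - n))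
  rw [pow_add, ← mul_assoc, ← mul_pow, mul_inv_cancel₀ hb.ne', one_pow, one_mul] at h3
  linarith

lemma forall_floor_eq_zero_iff (hβ : 1 < β) {y : ℝ} (h0 : 0 ≤ y) (h1 : y < 1) (k : ℕ) :
    (∀ i < k, ⌊β * (T β)^[i] y⌋ = 0) ↔ y < β⁻¹ ^ k := by
  have hb : 0 < β := by linarith
  have hb1 := inv_lt_one_of_one_lt₀ hβ
  induction k with
  | zero => simpa
  | succ k ih =>
    have key : y < β⁻¹ ^ k → (⌊β * (T β)^[k] y⌋ = 0 ↔ y < β⁻¹ ^ (k + 1)) := by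
      intro h
      rw [iterate_T_of_lt hβ h0 h, Int.floor_eq_zero_iff, mem_Ico, ← mul_assoc, ← pow_succ',
        inv_pow, ← one_div, lt_div_iff₀' (by positivity)]
      exact and_iff_right (by positivity)
    constructor
    · intro h
      exact (key (ih.1 fun i hi => h i (by lia))).1 (h k (by lia))
    · intro h i hi
      have hk : y < β⁻¹ ^ k :=
        h.trans_le (pow_le_pow_of_le_one (by positivity) hb1.le (by lia))
      rcases Nat.lt_succ_iff_lt_or_eq.1 hi with hi | rfl
      · exact ih.2 hk i hi
      · exact (key hk).2 h

/-- The run of zeros after the `n`-th digit has length at least `k` iff `T^n x < β^{-k}`. -/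
lemma le_zeroRun_iff (hβ : 1 < β) {x : ℝ} (h0 : 0 ≤ x) (h1 : x < 1) (n k : ℕ) :
    (k : ℕ∞) ≤ zeroRun β n x ↔ (T β)^[n] x < β⁻¹ ^ k := by
  rw [← forall_floor_eq_zero_iff hβ (iterate_T_nonneg h0 n) (iterate_T_lt_one h1 n)]
  have e : ∀ k : ℕ, (∀ i < k, ⌊β * (T β)^[i] ((T β)^[n] x)⌋ = 0) ↔
      ∀ i : ℕ, 1 ≤ i → i ≤ k → digit β (n + i) x = 0 := by
    intro k
    constructor
    · intro h i hi hik
      have := h (i - 1) (by lia)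
      rwa [← Function.iterate_add_apply, show i - 1 + n = n + i - 1 by lia] at this
    · intro h i hi
      have := h (i + 1) (by lia) (by lia)
      rwa [digit, show n + (i + 1) - 1 = i + n by lia, Function.iterate_add_apply] at this
  rw [e, zeroRun]
  constructor
  · intro h
    cases k with
    | zero => intro i hi hi'; lia
    | succ k =>
      have hk : (k : ℕ∞) < ((k + 1 : ℕ) : ℕ∞) := by exact_mod_cast Nat.lt_succ_self k
      obtain ⟨_, ⟨K, rfl, hK⟩, hlt⟩ := lt_sSup_iff.1 (hk.trans_le h)
      have hlt : k < K := by exact_mod_cast hlt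
      exact fun i hi hik => hK i hi (by lia)
  · intro h
    exact le_sSup ⟨k, rfl, h⟩

/-! ### Counting full cylinders and decomposing arbitrary ones. -/

/-- The left endpoints of full cylinders of order `n`. -/
def fullSet (β : ℝ) (n : ℕ) : Set ℝ := {v | IsFull β n v}

/-- Left endpoints are at least `β^{-n}` apart, so after scaling by `β^n` they have distinct integer
parts. -/
lemma fullSet_injOn_floor (hβ : 1 < β) (n : ℕ) :
    InjOn (fun v : ℝ => ⌊β ^ n * v⌋₊) (fullSet β n) := by
  have hb : 0 < β := by linarith
  have e : β ^ n * β⁻¹ ^ n = 1 := by rw [← mul_pow, mul_inv_cancel₀ hb.ne', one_pow]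
  have key : ∀ v ∈ fullSet β n, ∀ w ∈ fullSet β n, v < w → ⌊β ^ n * v⌋₊ < ⌊β ^ n * w⌋₊ := by
    intro v hv w hw h
    have h1 := mul_le_mul_of_nonneg_left (IsFull.add_le_of_lt hβ hv hw h) (pow_pos hb n).le
    rw [mul_add, e] at h1
    have hv0 : 0 ≤ β ^ n * v := mul_nonneg (by positivity) hv.nonneg
    have := Nat.floor_le_floor h1
    rw [Nat.floor_add_one hv0] at this
    lia
  intro v hv w hw h
  rcases lt_trichotomy v w with hlt | rfl | hlt
  · exact absurd h (key v hv w hw hlt).ne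
  · rfl
  · exact absurd h (key w hw v hv hlt).ne'

lemma fullSet_mapsTo_floor (hβ : 1 < β) (n : ℕ) :
    MapsTo (fun v : ℝ => ⌊β ^ n * v⌋₊) (fullSet β n) (Iio ⌊β ^ n⌋₊) := by
  have hb : 0 < β := by linarith
  have e : β ^ n * β⁻¹ ^ n = 1 := by rw [← mul_pow, mul_inv_cancel₀ hb.ne', one_pow]
  intro v hv
  have h1 := mul_le_mul_of_nonneg_left hv.add_le_one (pow_pos hb n).le
  rw [mul_add, e, mul_one] at h1
  have hv0 : 0 ≤ β ^ n * v := mul_nonneg (by positivity) hv.nonneg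
  have := Nat.floor_le_floor h1
  rw [Nat.floor_add_one hv0] at this
  simp only [mem_Iio]
  lia

lemma finite_fullSet (hβ : 1 < β) (n : ℕ) : (fullSet β n).Finite :=
  Finite.of_injOn (fullSet_mapsTo_floor hβ n) (fullSet_injOn_floor hβ n) (finite_Iio _)

lemma ncard_fullSet_le (hβ : 1 < β) (n : ℕ) : ((fullSet β n).ncard : ℝ) ≤ β ^ n := by
  have h := ncard_le_ncard_of_injOn _ (fullSet_mapsTo_floor hβ n) (fullSet_injOn_floor hβ n)
    (finite_Iio _)
  have h2 : (Iio ⌊β ^ n⌋₊).ncard = ⌊β ^ n⌋₊ := by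
    rw [← Finset.coe_Iio, ncard_coe_finset, Nat.card_Iio]
  rw [h2] at h
  exact (Nat.cast_le.2 h).trans (Nat.floor_le (by positivity))

/-- Points of `[0, 1)` lie in a full cylinder of positive order at most `n`, unless they lie in the
rightmost cylinder of order `n`. -/
lemma exists_isFull_or (hβ : 1 < β) (n : ℕ) : ∃ a c : ℝ, 0 ≤ a ∧ 0 < c ∧ c ≤ 1 ∧
    a + β⁻¹ ^ n * c = 1 ∧ (∀ z, 0 ≤ z → z < c → (T β)^[n] (a + β⁻¹ ^ n * z) = z) ∧
    ∀ x, 0 ≤ x → x < a → ∃ i, 1 ≤ i ∧ i ≤ n ∧ ∃ v, IsFull β i v ∧ v ≤ x ∧ x < v + β⁻¹ ^ i := by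
  have hb : 0 < β := by linarith
  induction n with
  | zero => exact ⟨0, 1, le_rfl, one_pos, le_rfl, by simp, fun z _ _ => by simp,
      fun x h0 h1 => absurd h0 h1.not_ge⟩
  | succ n ih =>
    obtain ⟨a, c, ha, hc, hc1, hac, hT, hex⟩ := ih
    have hp := inv_pow_pos hβ n
    -- The last digit available after the rightmost cylinder, whose image is `[0, c)`. The interval
    -- is half-open, so when `β * c` is an integer the last digit is `β * c - 1`; hence the ceiling
    -- minus one. Smaller digits give full cylinders.
    set d : ℤ := ⌈β * c⌉ - 1 with hd
    have hd0 : 0 ≤ d := by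
      have : 0 < ⌈β * c⌉ := Int.ceil_pos.2 (by positivity)
      lia
    have hd0' : (0 : ℝ) ≤ d := by exact_mod_cast hd0
    have hd1 : (d : ℝ) < β * c := by
      have := Int.ceil_lt_add_one (β * c)
      rw [hd]; push_cast; linarith
    have hd2 : β * c ≤ d + 1 := by
      have := Int.le_ceil (β * c)
      rw [hd]; push_cast; linarith
    have hstep : ∀ (e : ℤ) (z : ℝ), 0 ≤ e → 0 ≤ z → z < 1 → e + z < β * c →
        (T β)^[n + 1] (a + β⁻¹ ^ n * (e / β) + β⁻¹ ^ (n + 1) * z) = z := by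
      intro e z he h0 h1 h2
      have he' : (0 : ℝ) ≤ e := by exact_mod_cast he
      have e1 : a + β⁻¹ ^ n * (e / β) + β⁻¹ ^ (n + 1) * z = a + β⁻¹ ^ n * ((e + z) / β) := by
        rw [pow_succ]; field_simp; ring
      have e2 : β * ((e + z) / β) = e + z := by field_simp
      rw [e1, Function.iterate_succ_apply', hT _ (by positivity)
        (by rw [div_lt_iff₀ hb]; linarith), T_eq_of_mem e (by rw [e2]; linarith)
        (by rw [e2]; linarith), e2]
      ring
    refine ⟨a + β⁻¹ ^ n * (d / β), β * c - d, by positivity, by linarith, by linarith, ?_, ?_, ?_⟩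
    · rw [← hac, pow_succ]; field_simp; ring
    · intro z h0 h1
      exact hstep d z hd0 h0 (by linarith) (by linarith)
    · intro x h0 h1
      by_cases hx : x < a
      · obtain ⟨i, h1, h2, h⟩ := hex x h0 hx
        exact ⟨i, h1, by lia, h⟩
      · push Not at hx
        set z := (x - a) / β⁻¹ ^ n with hz
        have hz0 : 0 ≤ z := div_nonneg (by linarith) hp.le
        have hxz : x = a + β⁻¹ ^ n * z := by rw [hz, mul_div_cancel₀ _ hp.ne']; ring
        have hzd : β * z < d := by
          have : β⁻¹ ^ n * z < β⁻¹ ^ n * (d / β) := by linarith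
          have := lt_of_mul_lt_mul_left this hp.le
          rw [lt_div_iff₀ hb] at this
          linarith
        have hfd : ⌊β * z⌋ < d := Int.floor_lt.2 hzd
        have hfd' : (⌊β * z⌋ : ℝ) + 1 ≤ d := by exact_mod_cast hfd
        have hf0 : 0 ≤ ⌊β * z⌋ := Int.floor_nonneg.2 (by positivity)
        have hf0' : (0 : ℝ) ≤ ⌊β * z⌋ := by exact_mod_cast hf0
        have e3 : a + β⁻¹ ^ n * (⌊β * z⌋ / β) + β⁻¹ ^ (n + 1) =
            a + β⁻¹ ^ n * ((⌊β * z⌋ + 1) / β) := by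
          rw [pow_succ]; field_simp; ring
        refine ⟨n + 1, by lia, le_rfl, a + β⁻¹ ^ n * (⌊β * z⌋ / β),
          ⟨by positivity, ?_, fun y h0 h1 => hstep _ y hf0 h0 h1 (by linarith)⟩, ?_, ?_⟩
        · rw [e3, ← hac]
          gcongr
          rw [div_le_iff₀ hb]
          linarith
        · rw [hxz]
          gcongr
          rw [div_le_iff₀ hb]
          linarith [Int.floor_le (β * z)]
        · rw [e3, hxz]
          gcongr
          rw [lt_div_iff₀ hb]
          linarith [Int.lt_floor_add_one (β * z)]

/-- Every point is in a cylinder of order `n` which is a full cylinder of order `k ≤ n` followed by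
the rightmost cylinder of order `n - k`. -/
lemma exists_decomposition (hβ : 1 < β) : ∃ a : ℕ → ℝ, ∀ n : ℕ, ∀ x : ℝ, 0 ≤ x → x < 1 →
    ∃ k ≤ n, ∃ v, IsFull β k v ∧ x = v + β⁻¹ ^ k * a (n - k) + β⁻¹ ^ n * (T β)^[n] x := by
  choose a c ha hc hc1 hac hT hex using exists_isFull_or hβ
  refine ⟨a, fun n => ?_⟩
  induction n using Nat.strong_induction_on with
  | _ n ih =>
    intro x h0 h1
    by_cases hx : x < a n
    · obtain ⟨i, hi1, hin, v, hv, hvx, hxv⟩ := hex n x h0 hx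
      have hp := inv_pow_pos hβ i
      set z := (x - v) / β⁻¹ ^ i with hz
      have hz0 : 0 ≤ z := div_nonneg (by linarith) hp.le
      have hz1 : z < 1 := by rw [hz, div_lt_one hp]; linarith
      have hxz : x = v + β⁻¹ ^ i * z := by rw [hz, mul_div_cancel₀ _ hp.ne']; ring
      have hTz : (T β)^[n] x = (T β)^[n - i] z := by
        conv_lhs => rw [← Nat.sub_add_cancel hin, Function.iterate_add_apply, hxz]
        rw [hv.iterate z hz0 hz1]
      -- The full prefix of length `i ≥ 1` is split off, and the remaining `n - i` digits are
      -- decomposed by induction.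
      obtain ⟨k, hk, w, hw, hzw⟩ := ih (n - i) (by lia) z hz0 hz1
      refine ⟨i + k, by lia, _, hv.append hβ hw, ?_⟩
      rw [hTz, ← Nat.sub_sub]
      conv_lhs => rw [hxz, hzw]
      have : β⁻¹ ^ n = β⁻¹ ^ i * β⁻¹ ^ (n - i) := by rw [← pow_add]; congr 1; lia
      rw [this, pow_add]
      ring
    · push Not at hx
      have hp := inv_pow_pos hβ n
      set z := (x - a n) / β⁻¹ ^ n with hz
      have hz0 : 0 ≤ z := div_nonneg (by linarith) hp.le
      have hxz : x = a n + β⁻¹ ^ n * z := by rw [hz, mul_div_cancel₀ _ hp.ne']; ring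
      have hz1 : z < c n := by
        have := hac n
        exact lt_of_mul_lt_mul_left (a := β⁻¹ ^ n) (by linarith) hp.le
      refine ⟨0, by lia, 0, IsFull.zero hβ 0, ?_⟩
      have : (T β)^[n] x = z := by rw [hxz]; exact hT n z hz0 hz1
      rw [this]
      simpa using hxz

/-- The decomposition covers `[0, 1)` by intervals of length `β^{-n}` indexed by a prefix length and
a full word. Padding the full word with zeros makes it one of order `n`, so comparing lengths gives
the bound. -/
lemma le_ncard_fullSet (hβ : 1 < β) (n : ℕ) : β ^ n ≤ (n + 1) * (fullSet β n).ncard := by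
  have hb : 0 < β := by linarith
  have hp := inv_pow_pos hβ n
  obtain ⟨a, ha⟩ := exists_decomposition hβ
  set S := (finite_fullSet hβ n).toFinset with hS
  have hcov : Ico (0 : ℝ) 1 ⊆ ⋃ i ∈ (Finset.range (n + 1) ×ˢ S),
      Ico (i.2 + β⁻¹ ^ i.1 * a (n - i.1)) (i.2 + β⁻¹ ^ i.1 * a (n - i.1) + β⁻¹ ^ n) := by
    rintro x ⟨h0, h1⟩
    obtain ⟨k, hk, v, hv, hx⟩ := ha n x h0 h1
    have h2 := iterate_T_nonneg (β := β) h0 n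
    have h3 := iterate_T_lt_one (β := β) h1 n
    simp only [mem_iUnion]
    refine ⟨(k, v), ?_, ?_⟩
    · rw [Finset.mem_product, Finset.mem_range, hS, Finite.mem_toFinset]
      exact ⟨by lia, hv.mono hβ hk⟩
    · constructor <;> dsimp only <;> nlinarith
  have h1 := (measure_mono (μ := volume) hcov).trans (measure_biUnion_finset_le _ _)
  simp only [Real.volume_Ico, sub_zero, add_sub_cancel_left, Finset.sum_const,
    Finset.card_product, Finset.card_range, nsmul_eq_mul] at h1
  rw [← ENNReal.ofReal_natCast, ← ENNReal.ofReal_mul (by positivity),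
    ENNReal.ofReal_le_ofReal_iff (by positivity), hS,
    ← ncard_eq_toFinset_card _ (finite_fullSet hβ n)] at h1
  rw [inv_pow, ← div_eq_mul_inv, le_div_iff₀ (by positivity), one_mul] at h1
  exact_mod_cast h1

/-! ### The upper bound. -/

/-- Upper bound for the dimension of a set of points covered infinitely often. -/
lemma dimH_le_of_frequently_cover {X : Type*} [EMetricSpace X] {S : Set X} {ι : ℕ → Type*}
    [∀ n, Fintype (ι n)]
    (U : ∀ n, ι n → Set X) (d : ℕ → ℝ≥0∞) (hd : Tendsto d atTop (𝓝 0)) (hanti : Antitone d)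
    (hU : ∀ n i, Metric.ediam (U n i) ≤ d n) (s : ℝ≥0)
    (hsum : ∑' n, (Fintype.card (ι n) : ℝ≥0∞) * d n ^ (s : ℝ) ≠ ∞)
    (hS : ∀ x ∈ S, ∃ᶠ n in atTop, ∃ i, x ∈ U n i) : dimH S ≤ s := by
  borelize X
  apply dimH_le_of_hausdorffMeasure_ne_top
  refine ne_top_of_le_ne_top hsum ?_
  refine (Measure.hausdorffMeasure_le_liminf_tsum (ι := fun N => Σ n : ℕ, ι (n + N)) (s : ℝ) S
    (l := atTop) d hd (fun N p => U (p.1 + N) p.2)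
    (Eventually.of_forall fun N p => (hU _ _).trans (hanti (by lia)))
    (Eventually.of_forall fun N x hx => ?_)).trans ?_
  · obtain ⟨n, hn, i, hi⟩ := frequently_atTop.1 (hS x hx) N
    obtain ⟨k, rfl⟩ := Nat.exists_eq_add_of_le' hn
    exact mem_iUnion.2 ⟨⟨k, i⟩, hi⟩
  · refine liminf_le_of_frequently_le' (Eventually.of_forall fun N => ?_).frequently
    rw [ENNReal.tsum_sigma (fun (n : ℕ) (i : ι (n + N)) => Metric.ediam (U (n + N) i) ^ (s : ℝ))]
    calc ∑' (n : ℕ) (i : ι (n + N)), Metric.ediam (U (n + N) i) ^ (s : ℝ)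
        ≤ ∑' n : ℕ, (Fintype.card (ι (n + N)) : ℝ≥0∞) * d (n + N) ^ (s : ℝ) := by
          refine ENNReal.tsum_le_tsum fun n => ?_
          rw [tsum_fintype, ← nsmul_eq_mul]
          exact Finset.sum_le_card_nsmul _ _ _ fun i _ =>
            ENNReal.rpow_le_rpow (hU _ i) s.coe_nonneg
      _ ≤ _ := ENNReal.tsum_comp_le_tsum_of_injective (add_left_injective N)
            (fun n => (Fintype.card (ι n) : ℝ≥0∞) * d n ^ (s : ℝ))

/-- For `γ < δ < liminf φ(n)/n`, infinitely often `ℓ_n(x)/φ(n) > γ/δ`, while eventually `φ(n)/n >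
δ`; multiplying gives `ℓ_n(x) > γn`. -/
lemma frequently_of_mem_limsupSet (hβ : 1 < β) {φ : ℕ → ℝ} {γ : ℝ≥0}
    (hγ : (γ : ℝ≥0∞) < liminf (fun n : ℕ => ENNReal.ofReal (φ n) / (n : ℝ≥0∞)) atTop)
    {x : ℝ} (hx : x ∈ limsupSet β φ) :
    ∃ᶠ n : ℕ in atTop, (T β)^[n] x < β⁻¹ ^ ⌊(γ : ℝ) * n⌋₊ := by
  obtain ⟨h0, h1, hls⟩ := hx
  obtain ⟨δ, hγδ, hδ⟩ := ENNReal.lt_iff_exists_nnreal_btwn.1 hγ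
  have hγδ' : γ < δ := by exact_mod_cast hγδ
  have hδ0 : δ ≠ 0 := (pos_of_gt hγδ').ne'
  have hθ : ((γ / δ : ℝ≥0) : ℝ≥0∞) < 1 := by
    exact_mod_cast (div_lt_one (pos_of_gt hγδ')).2 hγδ'
  rw [← hls] at hθ
  refine ((frequently_lt_of_lt_limsup (by isBoundedDefault) hθ).and_eventually
    ((eventually_lt_of_lt_liminf hδ).and (eventually_ge_atTop 1))).mono ?_
  rintro n ⟨hn1, hn2, hn⟩
  rw [← le_zeroRun_iff hβ h0 h1]
  have hn0 : (n : ℝ≥0∞) ≠ 0 := by exact_mod_cast (by lia : n ≠ 0)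
  rw [ENNReal.lt_div_iff_mul_lt (Or.inl hn0) (Or.inl (ENNReal.natCast_ne_top n))] at hn2
  have hφ0 : ENNReal.ofReal (φ n) ≠ 0 := (pos_of_gt hn2).ne'
  rw [ENNReal.lt_div_iff_mul_lt (Or.inl hφ0) (Or.inl ENNReal.ofReal_ne_top)] at hn1
  have h3 : ((γ * n : ℝ≥0) : ℝ≥0∞) ≤ ((zeroRun β n x : ℕ∞) : ℝ≥0∞) := by
    refine le_trans ?_ hn1.le
    refine le_trans (le_of_eq ?_) (mul_le_mul_right hn2.le _)
    rw [← mul_assoc, ← ENNReal.coe_mul, div_mul_cancel₀ _ hδ0]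
    simp
  have h4 : (⌊(γ : ℝ) * n⌋₊ : ℝ≥0∞) ≤ ((γ * n : ℝ≥0) : ℝ≥0∞) := by
    have : (⌊(γ : ℝ) * n⌋₊ : ℝ≥0) ≤ γ * n := by
      rw [← NNReal.coe_le_coe]
      push_cast
      exact Nat.floor_le (by positivity)
    exact_mod_cast this
  have h5 := h4.trans h3
  rwa [← ENat.toENNReal_coe, ENat.toENNReal_le] at h5

lemma inv_pow_rpow_le (hβ : 1 < β) {γ s : ℝ} (hs : 0 ≤ s) (n : ℕ) :
    β ^ n * (β⁻¹ ^ (n + ⌊γ * n⌋₊)) ^ s ≤ β ^ s * (β ^ (1 - (1 + γ) * s)) ^ n := by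
  have hb : 0 < β := by linarith
  have e : β⁻¹ ^ (n + ⌊γ * n⌋₊) = β ^ (-((n : ℝ) + ⌊γ * n⌋₊)) := by
    rw [Real.rpow_neg hb.le, ← Nat.cast_add, Real.rpow_natCast, inv_pow]
  rw [e, ← Real.rpow_mul hb.le, ← Real.rpow_natCast β n, ← Real.rpow_add hb,
    ← Real.rpow_mul_natCast hb.le, ← Real.rpow_add hb]
  refine Real.rpow_le_rpow_of_exponent_le hβ.le ?_
  nlinarith [Nat.lt_floor_add_one (γ * n)]

lemma dimH_limsupSet_le_of_lt (hβ : 1 < β) {φ : ℕ → ℝ} {γ : ℝ≥0}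
    (hγ : (γ : ℝ≥0∞) < liminf (fun n : ℕ => ENNReal.ofReal (φ n) / (n : ℝ≥0∞)) atTop)
    {s : ℝ≥0} (hs : 1 < (1 + γ) * s) : dimH (limsupSet β φ) ≤ s := by
  have hb : 0 < β := by linarith
  have hb1 := inv_lt_one_of_one_lt₀ hβ
  obtain ⟨a, ha⟩ := exists_decomposition hβ
  have : ∀ n, Fintype (fullSet β n) := fun n => (finite_fullSet hβ n).fintype
  set k : ℕ → ℕ := fun n => n + ⌊(γ : ℝ) * n⌋₊ with hk
  have hkm : Monotone k := by
    intro m n h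
    simp only [hk]
    gcongr
  refine dimH_le_of_frequently_cover (ι := fun n => Fin (n + 1) × fullSet β n)
    (fun n p => Icc (p.2 + β⁻¹ ^ (p.1 : ℕ) * a (n - p.1))
      (p.2 + β⁻¹ ^ (p.1 : ℕ) * a (n - p.1) + β⁻¹ ^ (k n)))
    (fun n => ENNReal.ofReal (β⁻¹ ^ k n)) ?_ ?_ ?_ s ?_ ?_
  · rw [← ENNReal.ofReal_zero]
    refine ENNReal.tendsto_ofReal
      ((tendsto_pow_atTop_nhds_zero_of_lt_one (by positivity) hb1).comp ?_)
    exact tendsto_atTop_mono (fun n => Nat.le_add_right _ _) tendsto_id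
  · intro m n h
    exact ENNReal.ofReal_le_ofReal (pow_le_pow_of_le_one (by positivity) hb1.le (hkm h))
  · intro n p
    rw [Real.ediam_Icc, add_sub_cancel_left]
  · set ρ : ℝ := β ^ (1 - (1 + (γ : ℝ)) * s) with hρ
    have hs' : 1 < (1 + (γ : ℝ)) * s := by exact_mod_cast hs
    have hρ0 : 0 < ρ := Real.rpow_pos_of_pos hb _
    have hρ1 : ρ < 1 := Real.rpow_lt_one_of_one_lt_of_neg hβ (by linarith)
    have hsum : Summable fun n : ℕ => β ^ (s : ℝ) * (((n : ℝ) ^ 1 * ρ ^ n) + ρ ^ n) :=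
      ((summable_pow_mul_geometric_of_norm_lt_one 1
        (by rwa [Real.norm_of_nonneg hρ0.le])).add
        (summable_geometric_of_lt_one hρ0.le hρ1)).mul_left _
    refine ne_top_of_le_ne_top hsum.tsum_ofReal_ne_top (ENNReal.tsum_le_tsum fun n => ?_)
    rw [ENNReal.ofReal_rpow_of_nonneg (by positivity) s.coe_nonneg, ← ENNReal.ofReal_natCast,
      ← ENNReal.ofReal_mul (by positivity)]
    refine ENNReal.ofReal_le_ofReal ?_
    have hcard : (Fintype.card (Fin (n + 1) × fullSet β n) : ℝ) ≤ (n + 1) * β ^ n := by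
      rw [Fintype.card_prod, Fintype.card_fin, ← Nat.card_eq_fintype_card, Nat.card_coe_set_eq]
      push_cast
      gcongr
      exact ncard_fullSet_le hβ n
    calc (Fintype.card (Fin (n + 1) × fullSet β n) : ℝ) * (β⁻¹ ^ k n) ^ (s : ℝ)
        ≤ (n + 1) * β ^ n * (β⁻¹ ^ k n) ^ (s : ℝ) := by gcongr
      _ = (n + 1) * (β ^ n * (β⁻¹ ^ k n) ^ (s : ℝ)) := by ring
      _ ≤ (n + 1) * (β ^ (s : ℝ) * ρ ^ n) := by
          refine mul_le_mul_of_nonneg_left ?_ (by positivity)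
          exact inv_pow_rpow_le hβ s.coe_nonneg n
      _ = _ := by ring
  · intro x hx
    refine (frequently_of_mem_limsupSet hβ hγ hx).mono fun n hn => ?_
    obtain ⟨j, hj, v, hv, hxv⟩ := ha n x hx.1 hx.2.1
    refine ⟨(⟨j, by lia⟩, ⟨v, hv.mono hβ hj⟩), ?_⟩
    have hp := inv_pow_pos hβ n
    have h0 := iterate_T_nonneg (β := β) hx.1 n
    have h2 : β⁻¹ ^ n * (T β)^[n] x ≤ β⁻¹ ^ k n := by
      rw [hk, pow_add]
      gcongr
    have h3 : 0 ≤ β⁻¹ ^ n * (T β)^[n] x := by positivity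
    constructor <;> dsimp only <;> linarith

theorem dimH_limsupSet_le (hβ : 1 < β) (φ : ℕ → ℝ) :
    dimH (limsupSet β φ) ≤
      (1 + liminf (fun n : ℕ => ENNReal.ofReal (φ n) / (n : ℝ≥0∞)) atTop)⁻¹ := by
  set a := liminf (fun n : ℕ => ENNReal.ofReal (φ n) / (n : ℝ≥0∞)) atTop
  have h1 : dimH (limsupSet β φ) ≤ 1 := by
    simpa [Real.dimH_univ] using dimH_mono (subset_univ (limsupSet β φ))
  rw [← ENNReal.le_inv_iff_le_inv]
  have h1' : 1 ≤ (dimH (limsupSet β φ))⁻¹ := ENNReal.one_le_inv.2 h1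
  -- Passing to inverses reduces the claim to a bound on the liminf, tested on finite `γ` below it;
  -- an infinite liminf needs no separate case.
  rw [← add_tsub_cancel_of_le h1']
  gcongr
  refine ENNReal.le_of_forall_nnreal_lt fun γ hγ => ?_
  rw [ENNReal.le_sub_iff_add_le_left ENNReal.one_ne_top h1', ← ENNReal.le_inv_iff_le_inv]
  refine ENNReal.le_of_forall_pos_le_add fun ε hε _ => ?_
  have := dimH_limsupSet_le_of_lt hβ hγ (s := (1 + γ)⁻¹ + ε) (by
    rw [mul_add, mul_inv_cancel₀ (by positivity)]
    exact lt_add_of_pos_right _ (by positivity))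
  refine this.trans (le_of_eq ?_)
  push_cast
  rw [ENNReal.coe_inv (by positivity)]
  simp

/-! ### Tools for the lower bound. -/

/-- Lower bound for the dimension of a set coded by the full shift on `B` symbols. -/
lemma le_dimH_range_of_separated {E : Type*} [MetricSpace E] {B : ℕ} (hB : 1 < B)
    (X : (ℕ → Fin B) → E)
    {κ : ℝ} (hκ : 0 < κ) {r : ℝ≥0} (hr : 0 < r)
    (h : ∀ c c' : ℕ → Fin B, ∀ i, (∀ j < i, c j = c' j) → c i ≠ c' i →
      κ * ((B : ℝ) ^ i)⁻¹ ≤ dist (X c) (X c') ^ (r : ℝ)) : (r : ℝ≥0∞) ≤ dimH (range X) := by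
  have hB0 : (0 : ℝ) < B := by exact_mod_cast (by lia : 0 < B)
  have key : ∀ c c' : ℕ → Fin B, c ≠ c' → ∃ i, (∀ j < i, c j = c' j) ∧ c i ≠ c' i := by
    intro c c' hne
    have hex : ∃ i, c i ≠ c' i := Function.ne_iff.1 hne
    classical
    exact ⟨Nat.find hex, fun j hj => by simpa using Nat.find_min hex hj, Nat.find_spec hex⟩
  have hinj : Function.Injective X := by
    intro c c' hX
    by_contra hne
    obtain ⟨i, hi, hi'⟩ := key c c' hne
    have := h c c' i hi hi'
    rw [hX, dist_self, Real.zero_rpow (by exact_mod_cast hr.ne')] at this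
    have : 0 < κ * ((B : ℝ) ^ i)⁻¹ := by positivity
    linarith
  have hne : Nonempty (ℕ → Fin B) := ⟨fun _ => ⟨0, by lia⟩⟩
  -- Decode a point and read its code in base `B`. This is `r`-Hölder by separation and maps onto
  -- `[0, 1]`, so `1 ≤ dim / r`.
  set f : E → ℝ := Real.ofDigits ∘ Function.invFun X with hf
  have hfX : ∀ c, f (X c) = Real.ofDigits c := fun c => by
    rw [hf, Function.comp_apply, Function.leftInverse_invFun hinj c]
  have hhol : HolderOnWith (Real.toNNReal κ⁻¹) r f (range X) := by
    rintro _ ⟨c, rfl⟩ _ ⟨c', rfl⟩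
    rw [hfX, hfX]
    by_cases hcc : c = c'
    · simp [hcc]
    obtain ⟨i, hi, hi'⟩ := key c c' hcc
    have h1 := h c c' i hi hi'
    have h2 := Real.abs_ofDigits_sub_ofDigits_le hi
    rw [edist_dist, edist_dist, ENNReal.ofReal_rpow_of_nonneg dist_nonneg r.coe_nonneg,
      ← ENNReal.ofReal, ← ENNReal.ofReal_mul (by positivity), Real.dist_eq]
    refine ENNReal.ofReal_le_ofReal (h2.trans ?_)
    rw [← div_eq_inv_mul, le_div_iff₀ hκ]
    linarith
  have h1 := hhol.dimH_image_le hr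
  have h2 : Icc (0 : ℝ) 1 ⊆ f '' range X := by
    intro y hy
    obtain ⟨c, -, rfl⟩ := Real.ofDigits_SurjOn hB hy
    exact ⟨X c, mem_range_self c, hfX c⟩
  have h3 : dimH (Icc (0 : ℝ) 1) = 1 := by
    have := Real.dimH_of_nonempty_interior (s := Icc (0 : ℝ) 1) (by simp)
    simpa using this
  have h4 := (h3.symm.le.trans (dimH_mono h2)).trans h1
  rw [ENNReal.le_div_iff_mul_le (Or.inl (by exact_mod_cast hr.ne'))
    (Or.inl ENNReal.coe_ne_top), one_mul] at h4
  exact h4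

/-- The additive error `C` disappears in the ratio because `φ` tends to infinity. -/
lemma mem_limsupSet (hβ : 1 < β) {φ : ℕ → ℝ} (hpos : ∀ n : ℕ, 1 ≤ n → 0 < φ n)
    (hlim : Tendsto φ atTop atTop) {x C : ℝ} (h0 : 0 ≤ x) (h1 : x < 1)
    (hle : ∀ n : ℕ, 1 ≤ n → ∃ j : ℕ, (j : ℝ) ≤ φ n + C ∧ β⁻¹ ^ j ≤ (T β)^[n] x)
    (hfreq : ∃ᶠ n : ℕ in atTop, (T β)^[n] x < β⁻¹ ^ ⌈φ n⌉₊) : x ∈ limsupSet β φ := by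
  refine ⟨h0, h1, le_antisymm ?_ ?_⟩
  · have ht : Tendsto (fun n => ENNReal.ofReal (1 + C / φ n)) atTop (𝓝 1) := by
      have := ENNReal.tendsto_ofReal ((hlim.const_div_atTop C).const_add 1)
      simpa using this
    rw [← ht.limsup_eq]
    refine limsup_le_limsup ?_
    filter_upwards [eventually_ge_atTop 1] with n hn
    obtain ⟨j, hj, hjx⟩ := hle n hn
    have hφ := hpos n hn
    have h2 : zeroRun β n x < j := by
      rw [← not_le, le_zeroRun_iff hβ h0 h1]
      exact not_lt.2 hjx
    have h3 : ((zeroRun β n x : ℕ∞) : ℝ≥0∞) ≤ (j : ℝ≥0∞) := by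
      rw [← ENat.toENNReal_coe]
      exact ENat.toENNReal_le.2 h2.le
    have e : 1 + C / φ n = (φ n + C) / φ n := by field_simp
    rw [e, ENNReal.ofReal_div_of_pos hφ]
    gcongr
    refine h3.trans ?_
    rw [← ENNReal.ofReal_natCast]
    exact ENNReal.ofReal_le_ofReal hj
  · refine le_limsup_of_frequently_le' ((hfreq.and_eventually (eventually_ge_atTop 1)).mono ?_)
    rintro n ⟨hn, hn1⟩
    rw [← le_zeroRun_iff hβ h0 h1] at hn
    have hφ := hpos n hn1
    rw [ENNReal.le_div_iff_mul_le (Or.inl (by simpa using hφ)) (Or.inl ENNReal.ofReal_ne_top),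
      one_mul]
    have h3 : (⌈φ n⌉₊ : ℝ≥0∞) ≤ ((zeroRun β n x : ℕ∞) : ℝ≥0∞) := by
      rw [← ENat.toENNReal_coe]
      exact ENat.toENNReal_le.2 hn
    refine le_trans ?_ h3
    rw [← ENNReal.ofReal_natCast]
    exact ENNReal.ofReal_le_ofReal (Nat.le_ceil _)

/-- Infinite concatenation of full words. -/
lemma exists_concatenation (hβ : 1 < β) {l : ℕ → ℕ} {w : ℕ → ℝ} (hw : ∀ i, IsFull β (l i) (w i))
    (hlt : ∀ i, w i + β⁻¹ ^ l i < 1) :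
    ∃ y : ℕ → ℝ, (∀ i, 0 ≤ y i ∧ y i < 1) ∧ ∀ i, y i = w i + β⁻¹ ^ l i * y (i + 1) := by
  -- `u n i` concatenates `n` words from index `i` on, ending in zeros; it increases with `n`, and
  -- its supremum is the infinite concatenation.
  let u : ℕ → ℕ → ℝ := fun n => Nat.rec (fun _ => 0) (fun _ v i => w i + β⁻¹ ^ l i * v (i + 1)) n
  have hu0 : ∀ i, u 0 i = 0 := fun i => rfl
  have hus : ∀ n i, u (n + 1) i = w i + β⁻¹ ^ l i * u n (i + 1) := fun n i => rfl
  have hp : ∀ i, 0 < β⁻¹ ^ l i := fun i => inv_pow_pos hβ _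
  have hmono : ∀ i, Monotone fun n => u n i := by
    have : ∀ n i, u n i ≤ u (n + 1) i := by
      intro n
      induction n with
      | zero => intro i; rw [hus, hu0, hu0]; simpa using (hw i).nonneg
      | succ n ih =>
        intro i
        rw [hus n, hus (n + 1)]
        have := mul_le_mul_of_nonneg_left (ih (i + 1)) (hp i).le
        linarith
    exact fun i => monotone_nat_of_le_succ fun n => this n i
  have hle : ∀ n i, u n i ≤ 1 := by
    intro n
    induction n with
    | zero => intro i; rw [hu0]; exact zero_le_one
    | succ n ih =>
      intro i
      rw [hus]
      have := mul_le_mul_of_nonneg_left (ih (i + 1)) (hp i).le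
      linarith [hlt i]
  have hbdd : ∀ i, BddAbove (range fun n => u n i) := fun i =>
    ⟨1, by rintro _ ⟨n, rfl⟩; exact hle n i⟩
  have ht : ∀ i, Tendsto (fun n => u n i) atTop (𝓝 (⨆ n, u n i)) := fun i =>
    tendsto_atTop_ciSup (hmono i) (hbdd i)
  have hrec : ∀ i, (⨆ n, u n i) = w i + β⁻¹ ^ l i * ⨆ n, u n (i + 1) := fun i =>
    tendsto_nhds_unique ((tendsto_add_atTop_iff_nat 1).2 (ht i))
      (((ht (i + 1)).const_mul _).const_add _)
  have hy1 : ∀ i, (⨆ n, u n i) ≤ 1 := fun i => ciSup_le fun n => hle n i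
  refine ⟨fun i => ⨆ n, u n i, fun i => ⟨?_, ?_⟩, hrec⟩
  · exact (hu0 i).symm.le.trans (le_ciSup (hbdd i) 0)
  · have := mul_le_mul_of_nonneg_left (hy1 (i + 1)) (hp i).le
    dsimp only
    rw [hrec]
    linarith [hlt i]

/-- Block boundaries `t i`, with long blocks, marked by `p i ≠ 0`, inserted greedily. -/
lemma exists_blocks {φ : ℕ → ℝ} {a A : ℝ} {M q : ℕ} (hM : 1 ≤ M) (ha : 0 ≤ a) (hA : 1 + a < A)
    (hpos : ∀ n : ℕ, 1 ≤ n → 0 < φ n) (hfreq : ∃ᶠ n : ℕ in atTop, φ n ≤ a * n) :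
    ∃ t p : ℕ → ℕ, t 0 = 0 ∧ (∀ i, (t i : ℝ) ≤ A * M * i) ∧
      (∀ i, (p i = 0 ∧ t (i + 1) = t i + M) ∨
        (t i + M < p i ∧ p i ≤ t i + 2 * M ∧ t (i + 1) = p i + ⌈φ (p i)⌉₊ + q)) ∧
      ∃ᶠ i in atTop, p i ≠ 0 := by
  -- The last clause is the budget: a long block is admitted only if its end respects the linear
  -- bound `A * M * (i + 1)`. The window has `M` positions, so consecutive short blocks sweep every
  -- later integer.
  let good : ℕ → ℕ → ℕ → Prop := fun i t n =>
    t + M < n ∧ n ≤ t + 2 * M ∧ ((n + ⌈φ n⌉₊ + q : ℕ) : ℝ) ≤ A * M * (i + 1)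
  have hstep : ∀ i t : ℕ, ∃ t' p : ℕ, (p = 0 ∧ t' = t + M ∧ ∀ n, ¬ good i t n) ∨
      (good i t p ∧ t' = p + ⌈φ p⌉₊ + q) := by
    intro i t
    by_cases h : ∃ n, good i t n
    · obtain ⟨n, hn⟩ := h
      exact ⟨_, n, Or.inr ⟨hn, rfl⟩⟩
    · exact ⟨_, 0, Or.inl ⟨rfl, rfl, not_exists.1 h⟩⟩
  choose f g hfg using hstep
  obtain ⟨t, ht0, ht⟩ : ∃ t : ℕ → ℕ, t 0 = 0 ∧ ∀ i, t (i + 1) = f i (t i) :=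
    ⟨fun i => Nat.rec 0 f i, rfl, fun _ => rfl⟩
  have hcase : ∀ i, (g i (t i) = 0 ∧ t (i + 1) = t i + M ∧ ∀ n, ¬ good i (t i) n) ∨
      (good i (t i) (g i (t i)) ∧ t (i + 1) = g i (t i) + ⌈φ (g i (t i))⌉₊ + q) := fun i => by
    rw [ht]; exact hfg i (t i)
  refine ⟨t, fun i => g i (t i), ht0, ?_, ?_, ?_⟩
  · intro i
    induction i with
    | zero => simp [ht0]
    | succ i ih =>
      rcases hcase i with ⟨-, h, -⟩ | ⟨h, h'⟩
      · rw [h]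
        push_cast
        have : (0 : ℝ) ≤ M := by positivity
        nlinarith
      · rw [h']
        push_cast at *
        exact_mod_cast h.2.2
  · intro i
    rcases hcase i with ⟨h1, h2, -⟩ | ⟨h, h'⟩
    · exact Or.inl ⟨h1, h2⟩
    · exact Or.inr ⟨h.1, h.2.1, h'⟩
  · by_contra hcon
    rw [not_frequently] at hcon
    obtain ⟨i₀, hi₀⟩ := eventually_atTop.1 hcon
    have hbad : ∀ i, i₀ ≤ i → t (i + 1) = t i + M ∧ ∀ n, ¬ good i (t i) n := by
      intro i hi
      have h0 : g i (t i) = 0 := not_not.1 (hi₀ i hi)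
      rcases hcase i with ⟨-, h⟩ | ⟨h, -⟩
      · exact h
      · have := h.1; lia
    have hlin : ∀ k, t (i₀ + k) = t i₀ + M * k := by
      intro k
      induction k with
      | zero => simp
      | succ k ih => rw [← add_assoc, (hbad _ (by lia)).1, ih]; ring
    -- If no long block occurs from `i₀` on, any `n ≥ K` with `φ n ≤ a * n` satisfies `n + ⌈φ n⌉ + q
    -- ≤ A * (n - t i₀ - M)`, so it fits the budget in its window.
    set K : ℝ := (1 + q + A * ((t i₀ : ℝ) + M)) / (A - 1 - a) with hK
    obtain ⟨n, hn, hφn⟩ := frequently_atTop.1 hfreq (max (t i₀ + M + 1) ⌈K⌉₊)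
    have hn1 : t i₀ + M + 1 ≤ n := le_trans (le_max_left _ _) hn
    have hn2 : K ≤ n := Nat.ceil_le.1 (le_trans (le_max_right _ _) hn)
    rw [hK, div_le_iff₀ (by linarith)] at hn2
    set k := (n - (t i₀ + M + 1)) / M with hk
    have hdm := Nat.div_add_mod (n - (t i₀ + M + 1)) M
    have hml := Nat.mod_lt (n - (t i₀ + M + 1)) (by lia : M > 0)
    rw [← hk] at hdm
    refine (hbad (i₀ + k) (by lia)).2 n ⟨?_, ?_, ?_⟩
    · rw [hlin]; lia
    · rw [hlin]; lia
    · have h1 : n ≤ t i₀ + M + (M * k + M) := by lia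
      have h1' : (n : ℝ) ≤ t i₀ + M + (M * k + M) := by exact_mod_cast h1
      have h2 := Nat.ceil_lt_add_one (hpos n (by lia)).le
      have h3 : (0 : ℝ) ≤ M * i₀ := by positivity
      push_cast
      have h4 : A * ((n : ℝ) - (t i₀ + M)) ≤ A * (M * (i₀ + k + 1)) := by
        refine mul_le_mul_of_nonneg_left ?_ (by linarith)
        linarith
      linarith

lemma exists_gap (hβ : 1 < β) : ∃ q : ℕ, β⁻¹ + β⁻¹ ^ (q + 1) < 1 := by
  have hb1 := inv_lt_one_of_one_lt₀ hβ
  obtain ⟨q, hq⟩ := exists_pow_lt_of_lt_one (sub_pos.2 hb1) hb1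
  refine ⟨q, ?_⟩
  have := pow_le_pow_of_le_one (by positivity : 0 ≤ β⁻¹) hb1.le (by lia : q ≤ q + 1)
  linarith

lemma IsFull.append_add_le (hβ : 1 < β) {n m : ℕ} {v w : ℝ} (hw : IsFull β m w) :
    v + β⁻¹ ^ n * w + β⁻¹ ^ (n + m) ≤ v + β⁻¹ ^ n := by
  have := mul_le_mul_of_nonneg_left hw.add_le_one (inv_pow_pos hβ n).le
  rw [pow_add]
  linarith

lemma exists_between_of_zero {t : ℕ → ℕ} (h0 : t 0 = 0) (ht : StrictMono t) (n : ℕ) :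
    ∃ i, t i ≤ n ∧ n < t (i + 1) := by
  induction n with
  | zero => exact ⟨0, h0.le, by have := ht (Nat.lt_succ_self 0); lia⟩
  | succ n ih =>
    obtain ⟨i, hi, hi'⟩ := ih
    rcases (Nat.succ_le_of_lt hi').lt_or_eq with h | h
    · exact ⟨i, by lia, h⟩
    · exact ⟨i + 1, by lia, by have := ht (Nat.lt_succ_self (i + 1)); lia⟩

/-- The block `v 1 0^q`, followed by `0^d 1 0^(s+q)` if the block is long. -/
lemma isFull_long_block (hβ : 1 < β) {m q d s : ℕ} {v : ℝ} (hq : β⁻¹ + β⁻¹ ^ (q + 1) < 1)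
    (hv : IsFull β m v) :
    IsFull β (m + (q + 1) + d + (q + s + 1))
      (v + β⁻¹ ^ m * β⁻¹ + β⁻¹ ^ (m + (q + 1) + d) * β⁻¹) := by
  have hs : β⁻¹ + β⁻¹ ^ (q + s + 1) ≤ 1 := by
    have := pow_le_pow_of_le_one (by positivity : 0 ≤ β⁻¹) (inv_lt_one_of_one_lt₀ hβ).le
      (by lia : q + 1 ≤ q + s + 1)
    linarith
  exact ((hv.append hβ (IsFull.inv hβ hq.le)).mono hβ (by lia)).append hβ (IsFull.inv hβ hs)

/-! ### The Cantor subset and its dimension. -/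

/-- The Cantor subset: points coded by sequences of full words of order `m`. -/
lemma le_dimH_limsupSet_of_fullSet (hβ : 1 < β) {φ : ℕ → ℝ} (hpos : ∀ n : ℕ, 1 ≤ n → 0 < φ n)
    (hmono : ∀ m n : ℕ, 1 ≤ m → m ≤ n → φ m ≤ φ n) (hlim : Tendsto φ atTop atTop)
    {a A : ℝ} (ha : 0 ≤ a) (hA : 1 + a < A) (hfreq : ∃ᶠ n : ℕ in atTop, φ n ≤ a * n)
    {q : ℕ} (hq : β⁻¹ + β⁻¹ ^ (q + 1) < 1) {m B : ℕ} (hB : 1 < B) (v : Fin B → ℝ)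
    (hinj : Function.Injective v) (hv : ∀ k, IsFull β m (v k)) :
    ENNReal.ofReal (Real.log B / (A * (m + (q + 1) : ℕ) * Real.log β)) ≤
      dimH (limsupSet β φ) := by
  have hb : 0 < β := by linarith
  have hb1 := inv_lt_one_of_one_lt₀ hβ
  set M : ℕ := m + (q + 1) with hM
  obtain ⟨t, p, ht0, htA, htp, hpf⟩ := exists_blocks (M := M) (q := q) (by lia) ha hA hpos hfreq
  set l : ℕ → ℕ := fun i => t (i + 1) - t i with hl
  have htlt : ∀ i, t i + M ≤ t (i + 1) := fun i => by
    rcases htp i with ⟨-, h⟩ | ⟨h, -, h'⟩ <;> lia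
  have htl : ∀ i, t (i + 1) = t i + l i := fun i => by have := htlt i; simp only [hl]; lia
  have htmono : StrictMono t := strictMono_nat_of_lt_succ fun i => by have := htlt i; lia
  -- The offset `p i - 1 - t i` makes the second `1` digit number `p i` of the whole expansion, so
  -- the long run starts right after it. Block positions do not depend on the code `c`.
  let w : (ℕ → Fin B) → ℕ → ℝ := fun c i =>
    v (c i) + β⁻¹ ^ m * β⁻¹ + if p i = 0 then 0 else β⁻¹ ^ (p i - 1 - t i) * β⁻¹
  have hlong : ∀ i, p i ≠ 0 → p i - 1 - t i = M + (p i - 1 - t i - M) ∧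
      l i = M + (p i - 1 - t i - M) + (q + ⌈φ (p i)⌉₊ + 1) := fun i hi => by
    have := htl i
    rcases htp i with ⟨h, -⟩ | ⟨h, -, h'⟩ <;> constructor <;> lia
  have hshort : ∀ i, p i = 0 → l i = M := fun i hi => by
    have := htl i
    rcases htp i with ⟨-, h⟩ | ⟨h, -, h'⟩ <;> lia
  have hwv : ∀ c i, v (c i) + β⁻¹ ^ m * β⁻¹ ≤ w c i := fun c i => by
    refine le_add_of_nonneg_right ?_
    split_ifs <;> positivity
  have hwfull : ∀ c i, IsFull β (l i) (w c i) ∧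
      w c i + β⁻¹ ^ l i ≤ v (c i) + β⁻¹ ^ m * (β⁻¹ + β⁻¹ ^ (q + 1)) := fun c i => by
    have e : v (c i) + β⁻¹ ^ m * (β⁻¹ + β⁻¹ ^ (q + 1)) = v (c i) + β⁻¹ ^ m * β⁻¹ + β⁻¹ ^ M := by
      rw [hM, pow_add]; ring
    by_cases hi : p i = 0
    · have ew : w c i = v (c i) + β⁻¹ ^ m * β⁻¹ := by simp only [w, if_pos hi, add_zero]
      rw [ew, hshort i hi, e]
      exact ⟨(hv _).append hβ (IsFull.inv hβ hq.le), le_rfl⟩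
    · obtain ⟨h1, h2⟩ := hlong i hi
      have ew : w c i = v (c i) + β⁻¹ ^ m * β⁻¹ + β⁻¹ ^ (M + (p i - 1 - t i - M)) * β⁻¹ := by
        simp only [w, if_neg hi]; rw [← h1]
      have hs : β⁻¹ + β⁻¹ ^ (q + ⌈φ (p i)⌉₊ + 1) ≤ 1 := by
        have := pow_le_pow_of_le_one (by positivity : 0 ≤ β⁻¹) hb1.le
          (by lia : q + 1 ≤ q + ⌈φ (p i)⌉₊ + 1)
        linarith
      rw [ew, h2, e]
      refine ⟨isFull_long_block hβ hq (hv _), ((IsFull.inv hβ hs).append_add_le hβ).trans ?_⟩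
      have := pow_le_pow_of_le_one (by positivity : 0 ≤ β⁻¹) hb1.le
        (Nat.le_add_right M (p i - 1 - t i - M))
      linarith
  have hpm := inv_pow_pos hβ m
  have hwlt : ∀ c i, w c i + β⁻¹ ^ l i < v (c i) + β⁻¹ ^ m := fun c i => by
    have := mul_lt_mul_of_pos_left hq hpm
    linarith [(hwfull c i).2]
  choose y hy01 hyrec using fun c : ℕ → Fin B =>
    exists_concatenation hβ (fun i => (hwfull c i).1)
      (fun i => (hwlt c i).trans_le (hv (c i)).add_le_one)
  have hTt : ∀ c i, (T β)^[t i] (y c 0) = y c i := by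
    intro c i
    induction i with
    | zero => rw [ht0]; rfl
    | succ i ih =>
      rw [htl, add_comm, Function.iterate_add_apply, ih, hyrec c i]
      exact (hwfull c i).1.iterate _ (hy01 c (i + 1)).1 (hy01 c (i + 1)).2
  have hylow : ∀ c i, v (c i) + β⁻¹ ^ m * β⁻¹ ≤ y c i := fun c i => by
    rw [hyrec]
    have := mul_nonneg (inv_pow_pos hβ (l i)).le (hy01 c (i + 1)).1
    linarith [hwv c i]
  have hyup : ∀ c i, y c i < v (c i) + β⁻¹ ^ m := fun c i => by
    rw [hyrec]
    have := mul_le_mul_of_nonneg_left (hy01 c (i + 1)).2.le (inv_pow_pos hβ (l i)).le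
    linarith [hwlt c i]
  -- The digit after each free word is nonzero. Together with the nonzero digit `p i` of a long
  -- block, these markers stop every zero run.
  have hTm : ∀ c i, β⁻¹ ^ 1 ≤ (T β)^[t i + m] (y c 0) := by
    intro c i
    rw [add_comm, Function.iterate_add_apply, hTt]
    set z := (y c i - v (c i)) / β⁻¹ ^ m with hz
    have hz0 : β⁻¹ ≤ z := by
      rw [hz, le_div_iff₀ hpm]; linarith [hylow c i]
    have hz1 : z < 1 := by
      rw [hz, div_lt_one hpm]; linarith [hyup c i]
    have e : y c i = v (c i) + β⁻¹ ^ m * z := by rw [hz, mul_div_cancel₀ _ hpm.ne']; ring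
    rw [e, (hv _).iterate z ((by positivity : (0 : ℝ) ≤ β⁻¹).trans hz0) hz1, pow_one]
    exact hz0
  have hTp : ∀ c i, p i ≠ 0 → β⁻¹ ^ 1 ≤ (T β)^[p i - 1] (y c 0) ∧
      (T β)^[p i] (y c 0) < β⁻¹ ^ ⌈φ (p i)⌉₊ := by
    intro c i hi
    obtain ⟨h1, h2⟩ := hlong i hi
    have htpi : t i + M < p i := by rcases htp i with ⟨h, -⟩ | ⟨h, -⟩ <;> lia
    set s := ⌈φ (p i)⌉₊ with hs
    set x' := y c (i + 1) with hx'
    have hx0 : 0 ≤ x' := (hy01 c (i + 1)).1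
    have hx1 : x' < 1 := (hy01 c (i + 1)).2
    have hqs := inv_pow_le_one hβ (q + s)
    have hqs' := inv_pow_pos hβ (q + s)
    have hsmall : β⁻¹ ^ (q + s) * x' < β⁻¹ ^ s := by
      have h3 := pow_le_pow_of_le_one (by positivity : 0 ≤ β⁻¹) hb1.le (Nat.le_add_left s q)
      nlinarith
    have hx1' : β⁻¹ ^ (q + s) * x' < 1 := by nlinarith
    set z := β⁻¹ * (1 + β⁻¹ ^ (q + s) * x') with hz
    have hz0 : β⁻¹ ≤ z := by
      rw [hz]; nlinarith [inv_pos.2 hb, mul_nonneg hqs'.le hx0]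
    have hz1 : z < 1 := by
      have h3 := pow_le_pow_of_le_one (by positivity : 0 ≤ β⁻¹) hb1.le
        (by lia : q + 1 ≤ q + s + 1)
      have h4 : z = β⁻¹ + β⁻¹ ^ (q + s + 1) * x' := by rw [hz]; ring
      have h5 := inv_pow_pos hβ (q + s + 1)
      nlinarith
    have hfull : IsFull β (p i - 1 - t i) (v (c i) + β⁻¹ ^ m * β⁻¹) :=
      ((hv (c i)).append hβ (IsFull.inv hβ hq.le)).mono hβ (by lia)
    have e : y c i = v (c i) + β⁻¹ ^ m * β⁻¹ + β⁻¹ ^ (p i - 1 - t i) * z := by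
      rw [hyrec c i, h2, ← h1]
      simp only [w, if_neg hi]
      rw [hz, pow_add _ (p i - 1 - t i)]
      ring
    have hTz : (T β)^[p i - 1] (y c 0) = z := by
      rw [show p i - 1 = p i - 1 - t i + t i by lia, Function.iterate_add_apply, hTt, e]
      exact hfull.iterate z ((by positivity : (0 : ℝ) ≤ β⁻¹).trans hz0) hz1
    refine ⟨by rw [hTz, pow_one]; exact hz0, ?_⟩
    have e2 : β * z = 1 + β⁻¹ ^ (q + s) * x' := by rw [hz, mul_inv_cancel_left₀ hb.ne']
    have hx2 : 0 ≤ β⁻¹ ^ (q + s) * x' := by positivity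
    rw [show p i = p i - 1 + 1 by lia, Function.iterate_succ_apply', hTz,
      T_eq_of_mem 1 (by rw [e2]; push_cast; linarith) (by rw [e2]; push_cast; linarith), e2]
    push_cast
    linarith
  have hmem : range (fun c => y c 0) ⊆ limsupSet β φ := by
    rintro _ ⟨c, rfl⟩
    have h0 := (hy01 c 0).1
    -- Outside a long run the next marker is less than `2 * M` away. Inside one, where `p i ≤ n`, it
    -- is at most about `φ (p i) + M` away, and monotonicity gives `φ (p i) ≤ φ n`.
    refine mem_limsupSet hβ hpos hlim (C := 2 * M + 1) h0 (hy01 c 0).2 ?_ ?_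
    · intro n hn
      have hφn := hpos n hn
      obtain ⟨i, hi, hi'⟩ := exists_between_of_zero ht0 htmono n
      rcases htp i with ⟨hp, ht⟩ | ⟨hp1, hp2, ht⟩
      · refine ⟨_, ?_, inv_pow_le_iterate_T hβ h0 (by lia) (hTm c (i + 1))⟩
        have : t (i + 1) + m - n + 1 ≤ 2 * M := by lia
        have : ((t (i + 1) + m - n + 1 : ℕ) : ℝ) ≤ 2 * M := by exact_mod_cast this
        linarith
      · by_cases hnp : n < p i
        · refine ⟨_, ?_, inv_pow_le_iterate_T hβ h0 (by lia) (hTp c i (by lia)).1⟩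
          have : p i - 1 - n + 1 ≤ 2 * M := by lia
          have : ((p i - 1 - n + 1 : ℕ) : ℝ) ≤ 2 * M := by exact_mod_cast this
          linarith
        · refine ⟨_, ?_, inv_pow_le_iterate_T hβ h0 (by lia) (hTm c (i + 1))⟩
          have h1 : t (i + 1) + m - n + 1 ≤ ⌈φ (p i)⌉₊ + M := by lia
          have h2 : ((t (i + 1) + m - n + 1 : ℕ) : ℝ) ≤ ⌈φ (p i)⌉₊ + M := by exact_mod_cast h1
          have h3 := Nat.ceil_lt_add_one (hpos (p i) (by lia)).le
          have h4 := hmono (p i) n (by lia) (by lia)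
          have h5 : (0 : ℝ) ≤ M := by positivity
          linarith
    · rw [frequently_atTop] at hpf ⊢
      intro N
      obtain ⟨i, hi, hpi⟩ := hpf N
      refine ⟨p i, ?_, (hTp c i hpi).2⟩
      have := htmono.id_le i
      rcases htp i with ⟨h, -⟩ | ⟨h, -⟩
      · lia
      · simp only [id] at this; lia
  have hagree : ∀ c c' : ℕ → Fin B, ∀ i, (∀ j < i, c j = c' j) →
      y c 0 - y c' 0 = β⁻¹ ^ t i * (y c i - y c' i) := by
    intro c c' i
    induction i with
    | zero => intro _; simp [ht0]
    | succ i ih =>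
      intro h
      have hw : w c i = w c' i := by simp only [w, h i (Nat.lt_succ_self i)]
      rw [ih fun j hj => h j (by lia), hyrec c i, hyrec c' i, hw, htl, pow_add]
      ring
  have hsep : ∀ c c' : ℕ → Fin B, ∀ i, (∀ j < i, c j = c' j) → c i ≠ c' i →
      β⁻¹ ^ (t i + (m + 1)) ≤ dist (y c 0) (y c' 0) := by
    -- The digit `1` after the free word pushes the right-hand point `β^{-(m+1)}` away from the left
    -- end of its cylinder, creating a gap.
    have key : ∀ c c' : ℕ → Fin B, ∀ i, v (c i) < v (c' i) →
        β⁻¹ ^ (m + 1) ≤ y c' i - y c i := by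
      intro c c' i h
      have := IsFull.add_le_of_lt hβ (hv _) (hv _) h
      rw [pow_succ]
      linarith [hylow c' i, hyup c i]
    intro c c' i h hne
    rw [Real.dist_eq, hagree c c' i h, abs_mul, abs_of_pos (inv_pow_pos hβ _), pow_add]
    refine mul_le_mul_of_nonneg_left ?_ (inv_pow_pos hβ _).le
    rcases lt_or_gt_of_ne (hinj.ne hne) with hlt | hlt
    · rw [abs_sub_comm]
      exact (key c c' i hlt).trans (le_abs_self _)
    · exact (key c' c i hlt).trans (le_abs_self _)
  have hlogβ : 0 < Real.log β := Real.log_pos hβ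
  have hB' : (1 : ℝ) < B := by exact_mod_cast hB
  have hlogB : 0 < Real.log B := Real.log_pos hB'
  have hM0 : (0 : ℝ) < M := by exact_mod_cast (by lia : 0 < M)
  have hA0 : 0 < A := by linarith
  set r : ℝ≥0 := Real.toNNReal (Real.log B / (A * M * Real.log β)) with hr
  have hrpos : 0 < Real.log B / (A * M * Real.log β) := by positivity
  have hrc : (r : ℝ) = Real.log B / (A * M * Real.log β) := Real.coe_toNNReal _ hrpos.le
  have hr0 : 0 < r := by rw [← NNReal.coe_pos, hrc]; exact hrpos
  change (r : ℝ≥0∞) ≤ _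
  refine (le_dimH_range_of_separated hB (fun c => y c 0)
    -- `κ` absorbs the fixed offset `m + 1`; the rest is `B = β^{A M r}` and `t i ≤ A * M * i`.
    (κ := β ^ (-((m + 1 : ℕ) * (r : ℝ)))) (Real.rpow_pos_of_pos hb _) hr0 ?_).trans
    (dimH_mono hmem)
  intro c c' i h hne
  refine le_trans ?_ (Real.rpow_le_rpow (inv_pow_pos hβ _).le (hsep c c' i h hne) r.coe_nonneg)
  have hBβ : (B : ℝ) = β ^ (A * M * r) := by
    have : A * M * (r : ℝ) = Real.logb β B := by
      rw [hrc, Real.logb]; field_simp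
    rw [this, Real.rpow_logb hb hβ.ne' (by linarith)]
  have e1 : ((B : ℝ) ^ i)⁻¹ = β ^ (-(A * M * r * i)) := by
    rw [Real.rpow_neg hb.le, Real.rpow_mul_natCast hb.le, ← hBβ]
  have e2 : (β⁻¹ ^ (t i + (m + 1))) ^ (r : ℝ) = β ^ (-((t i + (m + 1) : ℕ) * (r : ℝ))) := by
    rw [inv_pow, Real.inv_rpow (by positivity), ← Real.rpow_natCast, ← Real.rpow_mul hb.le,
      Real.rpow_neg hb.le]
  rw [e1, e2, ← Real.rpow_add hb]
  refine Real.rpow_le_rpow_of_exponent_le hβ.le ?_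
  have := mul_le_mul_of_nonneg_right (htA i) r.coe_nonneg
  push_cast
  linarith

/-! ### Letting the parameters tend to their limits. -/

lemma le_dimH_limsupSet_of_lt (hβ : 1 < β) {φ : ℕ → ℝ} (hpos : ∀ n : ℕ, 1 ≤ n → 0 < φ n)
    (hmono : ∀ m n : ℕ, 1 ≤ m → m ≤ n → φ m ≤ φ n) (hlim : Tendsto φ atTop atTop)
    {a A : ℝ} (ha : 0 ≤ a) (hA : 1 + a < A) (hfreq : ∃ᶠ n : ℕ in atTop, φ n ≤ a * n) :
    ENNReal.ofReal A⁻¹ ≤ dimH (limsupSet β φ) := by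
  have hb : 0 < β := by linarith
  have hlogβ : 0 < Real.log β := Real.log_pos hβ
  have hA0 : 0 < A := by linarith
  obtain ⟨q, hq⟩ := exists_gap hβ
  have hm : ∀ m : ℕ, ENNReal.ofReal ((m * Real.log β - Real.log (m + 1)) /
      (A * (m + (q + 1) : ℕ) * Real.log β)) ≤ dimH (limsupSet β φ) := by
    intro m
    set B := (fullSet β m).ncard with hB
    have hcard := le_ncard_fullSet hβ m
    have hB0 : (0 : ℝ) < B := by
      by_contra hneg
      have : (B : ℝ) = 0 := le_antisymm (not_lt.1 hneg) (by positivity)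
      rw [← hB, this, mul_zero] at hcard
      have := pow_pos hb m
      linarith
    have hlog : m * Real.log β - Real.log (m + 1) ≤ Real.log B := by
      have := Real.log_le_log (by positivity) hcard
      rw [Real.log_pow, Real.log_mul (by positivity) hB0.ne'] at this
      linarith
    have hle : ENNReal.ofReal ((m * Real.log β - Real.log (m + 1)) /
        (A * (m + (q + 1) : ℕ) * Real.log β)) ≤
        ENNReal.ofReal (Real.log B / (A * (m + (q + 1) : ℕ) * Real.log β)) := by
      refine ENNReal.ofReal_le_ofReal ?_
      gcongr
    refine hle.trans ?_
    by_cases hB1 : 1 < B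
    · have hfin := finite_fullSet hβ m
      have : Fintype (fullSet β m) := hfin.fintype
      have hcardB : Fintype.card (fullSet β m) = B := by
        rw [hB, ← Nat.card_coe_set_eq, Nat.card_eq_fintype_card]
      let ev := (Fintype.equivFinOfCardEq hcardB).symm
      exact le_dimH_limsupSet_of_fullSet hβ hpos hmono hlim ha hA hfreq hq hB1
        (fun k => (ev k : ℝ)) (Subtype.val_injective.comp ev.injective) fun k => (ev k).2
    · have : B = 1 := by
        have : 0 < B := by exact_mod_cast hB0
        lia
      simp [this]
  refine le_of_tendsto' (x := atTop) (ENNReal.tendsto_ofReal ?_) hm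
  have h1 : Tendsto (fun x : ℝ => Real.log x / x) atTop (𝓝 0) :=
    Real.isLittleO_log_id_atTop.tendsto_div_nhds_zero
  have h2 : ∀ c : ℝ, Tendsto (fun x : ℝ => c / x) atTop (𝓝 0) := fun c =>
    tendsto_id.const_div_atTop c
  -- The bound for `m`, written in `x = m + 1` with numerator and denominator divided by `x`; the
  -- polynomial loss `m + 1` and the padding `q + 1` vanish in the limit.
  have h3 : Tendsto (fun x : ℝ => (Real.log β - Real.log β / x - Real.log x / x) /
      (A * (1 + q / x) * Real.log β)) atTop (𝓝 A⁻¹) := by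
    have := (((h2 (Real.log β)).const_sub (Real.log β)).sub h1).div
      ((((h2 q).const_add 1).const_mul A).mul_const (Real.log β)) (by positivity)
    have e : (Real.log β - 0 - 0) / (A * (1 + 0) * Real.log β) = A⁻¹ := by
      rw [sub_zero, sub_zero, add_zero, mul_one]
      field_simp
    rwa [e] at this
  have h4 : Tendsto (fun m : ℕ => (m : ℝ) + 1) atTop atTop :=
    tendsto_natCast_atTop_atTop.atTop_add tendsto_const_nhds
  refine (h3.comp h4).congr fun m => ?_
  have hm0 : (0 : ℝ) < m + 1 := by positivity
  have hq0 : (0 : ℝ) < m + 1 + q := by positivity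
  simp only [Function.comp_apply]
  push_cast
  have e : (m : ℝ) + (q + 1) = m + 1 + q := by ring
  rw [e]
  field_simp
  ring

theorem le_dimH_limsupSet (hβ : 1 < β) {φ : ℕ → ℝ} (hpos : ∀ n : ℕ, 1 ≤ n → 0 < φ n)
    (hmono : ∀ m n : ℕ, 1 ≤ m → m ≤ n → φ m ≤ φ n) (hlim : Tendsto φ atTop atTop) :
    (1 + liminf (fun n : ℕ => ENNReal.ofReal (φ n) / (n : ℝ≥0∞)) atTop)⁻¹ ≤
      dimH (limsupSet β φ) := by
  set a := liminf (fun n : ℕ => ENNReal.ofReal (φ n) / (n : ℝ≥0∞)) atTop with ha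
  rw [ENNReal.inv_le_iff_inv_le]
  refine le_of_forall_gt_imp_ge_of_dense fun A hA => ?_
  rcases eq_or_ne A ∞ with rfl | hAtop
  · exact le_top
  lift A to ℝ≥0 using hAtop
  have haA : a < A - 1 := by
    rw [lt_tsub_iff_left]
    exact hA
  obtain ⟨δ, haδ, hδA⟩ := ENNReal.lt_iff_exists_nnreal_btwn.1 haA
  have hδA' : 1 + δ < A := by
    rw [lt_tsub_iff_left] at hδA
    exact_mod_cast hδA
  have hfreq : ∃ᶠ n : ℕ in atTop, φ n ≤ δ * n := by
    rw [ha] at haδ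
    refine ((frequently_lt_of_liminf_lt (by isBoundedDefault) haδ).and_eventually
      (eventually_ge_atTop 1)).mono ?_
    rintro n ⟨h, hn⟩
    have hn0 : (n : ℝ≥0∞) ≠ 0 := by exact_mod_cast (by lia : n ≠ 0)
    have h2 := h.le
    rw [ENNReal.div_le_iff hn0 (ENNReal.natCast_ne_top n)] at h2
    have e : (δ : ℝ≥0∞) * n = ENNReal.ofReal (δ * n) := by
      rw [ENNReal.ofReal_mul δ.coe_nonneg, ENNReal.ofReal_coe_nnreal, ENNReal.ofReal_natCast]
    rw [e, ENNReal.ofReal_le_ofReal_iff (by positivity)] at h2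
    exact h2
  have h := le_dimH_limsupSet_of_lt hβ hpos hmono hlim δ.coe_nonneg
    (A := A) (by exact_mod_cast hδA') hfreq
  have hA0 : 0 < A := pos_of_gt hδA'
  rw [ENNReal.inv_le_iff_inv_le]
  rwa [ENNReal.ofReal_inv_of_pos (by exact_mod_cast hA0), ENNReal.ofReal_coe_nnreal] at h

end BetaExpansion

theorem mainTheorem6 (β : ℝ) (hβ : 1 < β) (φ : ℕ → ℝ)
    (hpos : ∀ n : ℕ, 1 ≤ n → 0 < φ n)
    (hmono : ∀ m n : ℕ, 1 ≤ m → m ≤ n → φ m ≤ φ n)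
    (hlim : Tendsto φ atTop atTop) :
    dimH (BetaExpansion.limsupSet β φ) =
      1 / (1 + liminf (fun n : ℕ => ENNReal.ofReal (φ n) / (n : ℝ≥0∞)) atTop) := by
  rw [one_div]
  exact le_antisymm (BetaExpansion.dimH_limsupSet_le hβ φ)
    (BetaExpansion.le_dimH_limsupSet hβ hpos hmono hlim)
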